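/- Let $\rho$ be an odd prime with $\rho\equiv\pm5\pmod{12}$ such that the multiplicative order of $3$ modulo $\rho$ is $\rho-1$, and put $m=\rho-1$. Let $\alpha$ be a primitive element of $\mathrm{GF}(3^m)$, $\beta=\alpha^{(3^m-1)/(4\rho)}$ (a primitive $4\rho$-th root of unity) and $\theta=\beta^{-1}$. Consider the code over $\mathrm{GF}(3^2)$ of length $\rho$ $$\overline{\mathcal C}(\rho)=\left\{\left(\mathrm{Tr}_{3^m/3^2}(a\,\theta^{2i})\right)_{i=0}^{\rho-1}:\ a\in\mathrm{GF}(3^m)\right\},$$ where $\mathrm{Tr}_{3^m/3^2}$ is the trace from $\mathrm{GF}(3^m)$ to $\mathrm{GF}(3^2)$. Then $\overline{\mathcal C}(\rho)$ is negacyclic (if $(c_0,\ldots,c_{\rho-1})$ is a codeword, so is $(-c_{\rho-1},c_0,\ldots,c_{\rho-2})$) and is a linear code with parameters $[\rho,\frac{\rho-1}2,d]$, where the minimum Hamming distance satisfies $d\ge\sqrt\rho+1$. Its dual $\overline{\mathcal C}(\rho)^{\perp}=\{c\in\mathrm{GF}(3^2)^\rho:\ \sum_{i} c_ib_i=0\text{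 for all } b\in\overline{\mathcal C}(\rho)\}$ has parameters $[\rho,\frac{\rho+1}2,d^\perp]$ with $d^\perp\ge\sqrt\rho$. -/

import Mathlib

namespace Negacyclic

/-- A linear code of length `n` over `K` is `lam`-constacyclic if `(c_0, ..., c_{n-1}) ∈ C`
implies `(lam * c_{n-1}, c_0, ..., c_{n-2}) ∈ C`. -/
def IsConstacyclic {K : Type*} [Field K] {n : ℕ} (lam : K) (C : Submodule K (Fin n → K)) : Prop :=
  ∀ c ∈ C, (fun i : Fin n =>
    if i.val = 0 then lam * c ⟨n - 1, Nat.sub_lt i.pos one_pos⟩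
    else c ⟨i.val - 1, (Nat.sub_le _ _).trans_lt i.isLt⟩) ∈ C

/-- A negacyclic code is a `(-1)`-constacyclic code. -/
def IsNegacyclic {K : Type*} [Field K] {n : ℕ} (C : Submodule K (Fin n → K)) : Prop :=
  IsConstacyclic (-1 : K) C

/-- The (Euclidean) dual code. -/
def dualCode {K : Type*} [Field K] {n : ℕ} (C : Submodule K (Fin n → K)) :
    Submodule K (Fin n → K) where
  carrier := {c | ∀ b ∈ C, ∑ i, c i * b i = 0}
  zero_mem' := by
    intro b _
    simp
  add_mem' := by
    intro x y hx hy b hb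
    simp [add_mul, Finset.sum_add_distrib, hx b hb, hy b hb]
  smul_mem' := by
    intro r x hx b hb
    simp [mul_assoc, ← Finset.mul_sum, hx b hb]

open Classical in
/-- The minimum Hamming distance between two distinct codewords of a linear code
(with value `0` for the zero code, which has no two distinct codewords). -/
noncomputable def minDist {K : Type*} [Field K] {n : ℕ} (C : Submodule K (Fin n → K)) : ℕ :=
  sInf {d : ℕ | ∃ x ∈ C, ∃ y ∈ C, x ≠ y ∧ hammingDist x y = d}

/-- An `[n, k, d]` linear code over `K`: a `k`-dimensional subspace of `K^n` with minimum
distance `d`. -/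
def HasParameters {K : Type*} [Field K] {n : ℕ} (C : Submodule K (Fin n → K)) (k d : ℕ) : Prop :=
  Module.finrank K C = k ∧ minDist C = d

/-- With `θ = β⁻¹`, the code of all words `(Tr_{L/K}(a θ^{2 i}))_{0 ≤ i ≤ ρ - 1}`, `a ∈ L`. -/
noncomputable def barCode (K : Type*) {L : Type*} [Field K] [Field L] [Algebra K L]
    (ρ : ℕ) (β : L) : Submodule K (Fin ρ → K) :=
  LinearMap.range (LinearMap.pi fun i : Fin ρ =>
    Algebra.trace K L ∘ₗ LinearMap.mulRight K (β⁻¹ ^ (2 * i.val)))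

theorem mem_barCode {K L : Type*} [Field K] [Field L] [Algebra K L] (ρ : ℕ) (β : L)
    (c : Fin ρ → K) :
    c ∈ barCode K ρ β ↔
      ∃ a : L, c = fun i : Fin ρ => Algebra.trace K L (a * β⁻¹ ^ (2 * i.val)) := by
  constructor
  · rintro ⟨a, rfl⟩
    exact ⟨a, rfl⟩
  · rintro ⟨a, rfl⟩
    exact ⟨a, rfl⟩

end Negacyclic

/-!
Put `q = |K|` and `θ = β⁻¹`. Since `ρ` is odd, multiplying the coordinate `i` of a word by
`(-1) ^ i` turns the negacyclic problem into a cyclic one, governed by the primitive `ρ`-th root of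
unity `-θ ^ 2`. As `q` has order `(ρ - 1) / 2` modulo `ρ`, its powers are exactly the nonzero
squares, so Frobenius makes the Fourier transform of a dual word vanish at all nonzero squares, and,
after a dilation of the frequencies, that of a trace word vanish at all squares including `0`.

If `f` has no nonzero square frequency but has the frequency `0`, its convolution with a nonsquare
dilate of itself is a nonzero constant, so the sumset of its support with a dilate covers `ZMod ρ`
and `f` has weight at least `√ρ`. If the frequency `0` is missing too, then `f` is an eigenvector of
the matrix `(χ (y - x))`, with `χ` the quadratic character. After a translation `f 0 ≠ 0`, and the
Gleason–Prange substitution `x ↦ -1/x`, weighted by `χ`, moves `f 0` to the point at infinity: it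
produces a word of weight one less, still without nonzero square frequencies but now with the
frequency `0`. This gives the bound `√ρ + 1`.
-/

namespace Negacyclic

open Finset

section Fourier

variable {R L : Type*} [CommRing R] [Fintype R] [CommRing L] (ψ : AddChar R L)

/-- The Fourier transform on functions `R → L` attached to an additive character `ψ`, with the
normalization `f̂(r) = ∑ x, f x * ψ (x * r)`. The frequencies where it vanishes are the zeros of
the cyclic code word `f`. -/
def fourier : (R → L) →ₗ[L] (R → L) where
  toFun f r := ∑ x, f x * ψ (x * r)
  map_add' f g := by
    ext r
    simp only [Pi.add_apply, add_mul, sum_add_distrib]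
  map_smul' a f := by
    ext r
    simp only [Pi.smul_apply, smul_eq_mul, mul_assoc, mul_sum, RingHom.id_apply]

theorem fourier_apply (f : R → L) (r : R) : fourier ψ f r = ∑ x, f x * ψ (x * r) := rfl

theorem fourier_apply_zero (f : R → L) : fourier ψ f 0 = ∑ x, f x := by
  simp [fourier_apply]

theorem fourier_comp_add_right (f : R → L) (t r : R) :
    fourier ψ (fun x => f (x + t)) r = ψ (-(t * r)) * fourier ψ f r := by
  rw [fourier_apply, fourier_apply, ← Equiv.sum_comp (Equiv.addRight t) fun x => f x * ψ (x * r),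
    mul_sum]
  refine sum_congr rfl fun x _ => ?_
  have hsplit : ψ (x * r) = ψ (-(t * r)) * ψ ((x + t) * r) := by
    rw [← AddChar.map_add_eq_mul]
    ring_nf
  rw [Equiv.coe_addRight, hsplit, mul_left_comm]

theorem fourier_comp_unit_mul (f : R → L) (u : Rˣ) (r : R) :
    fourier ψ (fun x => f (u * x)) r = fourier ψ f (↑u⁻¹ * r) := by
  rw [fourier_apply, fourier_apply, ← Equiv.sum_comp u.mulLeft fun x => f x * ψ (x * (↑u⁻¹ * r))]
  refine sum_congr rfl fun x _ => ?_
  have hcancel : u * x * (↑u⁻¹ * r) = x * r := by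
    rw [mul_mul_mul_comm, Units.mul_inv, one_mul]
  rw [Units.mulLeft_apply, hcancel]

theorem fourier_convolution (f g : R → L) (r : R) :
    fourier ψ (fun z => ∑ y, f y * g (z - y)) r = fourier ψ f r * fourier ψ g r := by
  simp only [fourier_apply, sum_mul]
  rw [sum_comm]
  refine sum_congr rfl fun y _ => ?_
  rw [mul_sum, ← Equiv.sum_comp (Equiv.addRight y)]
  refine sum_congr rfl fun x _ => ?_
  rw [Equiv.coe_addRight, add_sub_cancel_right, add_mul, AddChar.map_add_eq_mul]
  ring

theorem fourier_mulShift (f : R → L) (m r : R) :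
    fourier (ψ.mulShift m) f r = fourier ψ f (m * r) := by
  simp only [fourier_apply, AddChar.mulShift_apply, mul_left_comm m]

variable {ψ} [IsDomain L]

theorem fourier_inversion (hψ : ψ.IsPrimitive) (f : R → L) (y : R) :
    ∑ r, fourier ψ f r * ψ (-(r * y)) = Fintype.card R * f y := by
  classical
  calc ∑ r, fourier ψ f r * ψ (-(r * y))
      = ∑ r, ∑ x, f x * ψ (r * (x - y)) := by
        refine sum_congr rfl fun r _ => ?_
        rw [fourier_apply, sum_mul]
        refine sum_congr rfl fun x _ => ?_
        rw [mul_assoc, ← AddChar.map_add_eq_mul]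
        ring_nf
    _ = ∑ x, f x * ∑ r, ψ (r * (x - y)) := by
        rw [sum_comm]
        simp only [mul_sum]
    _ = Fintype.card R * f y := by
        simp only [AddChar.sum_mulShift _ hψ, sub_eq_zero]
        simp [mul_comm]

theorem fourier_injective (hψ : ψ.IsPrimitive) (hR : (Fintype.card R : L) ≠ 0) :
    Function.Injective (fourier ψ) := by
  intro f g hfg
  funext y
  refine mul_left_cancel₀ hR ?_
  rw [← fourier_inversion hψ, ← fourier_inversion hψ, hfg]

end Fourier

section OddLike

theorem isSquare_mul_of_not_isSquare {F : Type*} [Field F] [Finite F] {a b : F}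
    (ha : ¬IsSquare a) (hb : ¬IsSquare b) :
    IsSquare (a * b) := by
  classical
  cases nonempty_fintype F
  by_contra hab
  rw [← quadraticChar_neg_one_iff_not_isSquare] at ha hb hab
  rw [map_mul, ha, hb] at hab
  norm_num at hab

variable {F L : Type*} [Field F] [Fintype F] [Field L] {ψ : AddChar F L} {f : F → L}

/-- A nonsquare dilation exchanges the squares with the nonsquares, so the convolution of `f` with
its dilate has no frequency but `0` and is a nonzero constant. -/
theorem exists_mul_comp_dilate_ne_zero (hF : ringChar F ≠ 2) (hψ : ψ.IsPrimitive)
    (hf : ∀ r ≠ 0, IsSquare r → fourier ψ f r = 0) (hf0 : fourier ψ f 0 ≠ 0) :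
    ∃ n : F, n ≠ 0 ∧ ∀ z, ∃ y, f y ≠ 0 ∧ f (n * (z - y)) ≠ 0 := by
  obtain ⟨n, hn⟩ := FiniteField.exists_nonsquare hF
  have hn0 : n ≠ 0 := fun h => hn (h ▸ IsSquare.zero)
  set h : F → L := fun z => ∑ y, f y * f (n * (z - y))
  have hfourier (r : F) : fourier ψ h r = fourier ψ f r * fourier ψ f (n⁻¹ * r) := by
    have := fourier_comp_unit_mul ψ f (Units.mk0 n hn0) r
    simp only [Units.val_mk0, Units.val_inv_eq_inv_val] at this
    rw [← this, ← fourier_convolution]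
  have hvanish (r : F) (hr : r ≠ 0) : fourier ψ h r = 0 := by
    rw [hfourier]
    by_cases hsq : IsSquare r
    · rw [hf r hr hsq, zero_mul]
    · rw [hf _ (mul_ne_zero (inv_ne_zero hn0) hr)
        (isSquare_mul_of_not_isSquare (by rwa [isSquare_inv]) hsq), mul_zero]
  refine ⟨n, hn0, fun z => ?_⟩
  have hz : h z ≠ 0 := by
    intro hz
    have hinv := fourier_inversion hψ h z
    rw [hz, mul_zero, sum_eq_single 0 (fun r _ hr => by rw [hvanish r hr, zero_mul]) (by simp),
      hfourier] at hinv
    simp [hf0] at hinv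
  obtain ⟨y, -, hy⟩ := exists_ne_zero_of_sum_ne_zero hz
  exact ⟨y, left_ne_zero_of_mul hy, right_ne_zero_of_mul hy⟩

variable [DecidableEq L]

theorem sqrt_card_le_hammingNorm_of_fourier_zero_ne_zero (hF : ringChar F ≠ 2)
    (hψ : ψ.IsPrimitive) (hf : ∀ r ≠ 0, IsSquare r → fourier ψ f r = 0)
    (hf0 : fourier ψ f 0 ≠ 0) : √(Fintype.card F) ≤ hammingNorm f := by
  classical
  obtain ⟨n, hn0, hn⟩ := exists_mul_comp_dilate_ne_zero hF hψ hf hf0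
  set supp : Finset F := {x | f x ≠ 0} with hsupp
  have hcover : (univ : Finset F) ⊆ (supp ×ˢ supp).image fun p => p.1 + n⁻¹ * p.2 := by
    intro z _
    obtain ⟨y, hy, hzy⟩ := hn z
    refine mem_image.2 ⟨(y, n * (z - y)), by simp [hsupp, hy, hzy], ?_⟩
    simp [inv_mul_cancel_left₀ hn0]
  have hcard : Fintype.card F ≤ hammingNorm f ^ 2 := by
    rw [sq, ← card_univ]
    exact (card_le_card hcover).trans (card_image_le.trans (card_product ..).le)
  exact Real.sqrt_le_iff.2 ⟨Nat.cast_nonneg _, by exact_mod_cast hcard⟩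

end OddLike

section GleasonPrange

variable {F L : Type*} [Field F] [Field L]

/-- The Gleason–Prange substitution `x ↦ -1/x`, twisted by `χ`; the point `0` is sent to infinity
and the new value at `0` is `χ 0 = 0`. -/
def gleasonPrange (χ : MulChar F L) (f : F → L) (x : F) : L := χ x * f (-x⁻¹)

theorem gleasonPrange_apply_zero (χ : MulChar F L) (f : F → L) : gleasonPrange χ f 0 = 0 := by
  rw [gleasonPrange, MulChar.map_zero, zero_mul]

theorem apply_mul_self_of_isQuadratic {χ : MulChar F L} (hχ : χ.IsQuadratic) {x : F} (hx : x ≠ 0) :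
    χ x * χ x = 1 := by
  rw [← MulChar.mul_apply, ← sq, hχ.sq_eq_one, MulChar.one_apply hx.isUnit]

theorem mul_gleasonPrange_neg_inv [DecidableEq F] {χ : MulChar F L} (hχ : χ.IsQuadratic)
    (f : F → L) (x u : F) :
    χ (-u⁻¹ - x) * gleasonPrange χ f (-u⁻¹)
      = χ (1 + x * u) * f u - if u = 0 then f 0 else 0 := by
  rcases eq_or_ne u 0 with rfl | hu
  · simp [gleasonPrange_apply_zero]
  · have hfactor : 1 + x * u = u * u * ((-u⁻¹ - x) * -u⁻¹) := by
      field_simp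
      ring
    have hχu : χ (1 + x * u) = χ (-u⁻¹ - x) * χ (-u⁻¹) := by
      rw [hfactor, map_mul, map_mul, apply_mul_self_of_isQuadratic hχ hu, one_mul, map_mul]
    simp [hχu, gleasonPrange, hu, mul_assoc]

end GleasonPrange

section Paley

variable {F L : Type*} [Field F] [Fintype F] [Field L]

theorem gaussSum_mulShift_of_ne_one {χ : MulChar F L} (hχ : χ ≠ 1) (ψ : AddChar F L) (r : F) :
    gaussSum χ (ψ.mulShift r) = χ⁻¹ r * gaussSum χ ψ := by
  rcases eq_or_ne r 0 with rfl | hr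
  · rw [AddChar.mulShift_zero, gaussSum_one_right hχ, MulChar.map_zero, zero_mul]
  · exact gaussSum_mulShift_eq χ ψ (Units.mk0 r hr)

/-- The Paley operator: the matrix `(χ (y - x))` acting on functions, which the Fourier
transform diagonalizes. -/
def paley (χ : MulChar F L) (f : F → L) (x : F) : L := ∑ y, χ (y - x) * f y

theorem fourier_paley {χ : MulChar F L} (hχ : χ ≠ 1) (ψ : AddChar F L) (f : F → L) (r : F) :
    fourier ψ (paley χ f) r = χ⁻¹ (-r) * gaussSum χ ψ * fourier ψ f r := by
  rw [← gaussSum_mulShift_of_ne_one hχ, gaussSum]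
  simp only [fourier_apply, paley, sum_mul, mul_sum]
  rw [sum_comm]
  refine sum_congr rfl fun y _ => ?_
  rw [← Equiv.sum_comp (Equiv.subLeft y)]
  refine sum_congr rfl fun z _ => ?_
  have hsplit : ψ ((y - z) * r) = ψ (-r * z) * ψ (y * r) := by
    rw [← AddChar.map_add_eq_mul]
    ring_nf
  rw [Equiv.subLeft_apply, sub_sub_cancel, hsplit, AddChar.mulShift_apply]
  ring

theorem hammingNorm_gleasonPrange_add_one [DecidableEq L] (χ : MulChar F L) {f : F → L}
    (hf : f 0 ≠ 0) : hammingNorm (gleasonPrange χ f) + 1 = hammingNorm f := by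
  classical
  have h0 : (0 : F) ∈ ({x | f x ≠ 0} : Finset F) := by simpa using hf
  rw [hammingNorm, hammingNorm, ← card_erase_add_one h0, Nat.add_right_cancel_iff]
  refine card_equiv ((Equiv.inv F).trans (Equiv.neg F)) fun x => ?_
  rcases eq_or_ne x 0 with rfl | hx
  · simp [gleasonPrange_apply_zero]
  · simp [gleasonPrange, hx, (hx.isUnit.map χ).ne_zero]

theorem paley_gleasonPrange {χ : MulChar F L} (hχ : χ.IsQuadratic) {f : F → L} {l : L}
    (hf : paley χ f = l • f) (hsum : ∑ x, f x = 0) :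
    paley χ (gleasonPrange χ f) = l • gleasonPrange χ f - fun _ => f 0 := by
  classical
  funext x
  have hsubst : paley χ (gleasonPrange χ f) x = ∑ u, χ (1 + x * u) * f u - f 0 := by
    rw [paley, ← Equiv.sum_comp ((Equiv.inv F).trans (Equiv.neg F))]
    simp [mul_gleasonPrange_neg_inv hχ]
  have hsum' : ∑ u, χ (1 + x * u) * f u = l * gleasonPrange χ f x := by
    rcases eq_or_ne x 0 with rfl | hx
    · simp [hsum, gleasonPrange_apply_zero]
    · calc ∑ u, χ (1 + x * u) * f u
          = χ x * paley χ f (-x⁻¹) := by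
            rw [paley, mul_sum]
            refine sum_congr rfl fun u _ => ?_
            rw [← mul_assoc, ← map_mul, sub_neg_eq_add, mul_add, mul_inv_cancel₀ hx, add_comm]
        _ = l * gleasonPrange χ f x := by
            rw [hf, Pi.smul_apply, smul_eq_mul, mul_left_comm, gleasonPrange]
  rw [hsubst, hsum', Pi.sub_apply, Pi.smul_apply, smul_eq_mul]

theorem fourier_gleasonPrange [DecidableEq F] {χ : MulChar F L} (hχ : χ.IsQuadratic) (hχ1 : χ ≠ 1)
    {ψ : AddChar F L} (hψ : ψ.IsPrimitive) {f : F → L} {l : L} (hf : paley χ f = l • f)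
    (hsum : ∑ x, f x = 0) (r : F) :
    (l - χ (-r) * gaussSum χ ψ) * fourier ψ (gleasonPrange χ f) r
      = if r = 0 then Fintype.card F * f 0 else 0 := by
  have hconst : fourier ψ (fun _ => f 0) r = if r = 0 then Fintype.card F * f 0 else 0 := by
    rw [fourier_apply, ← mul_sum, AddChar.sum_mulShift r hψ, mul_comm]
    split_ifs <;> simp
  have h := fourier_paley hχ1 ψ (gleasonPrange χ f) r
  rw [paley_gleasonPrange hχ hf hsum, map_sub, map_smul, Pi.sub_apply, Pi.smul_apply, smul_eq_mul,
    hχ.inv, hconst] at h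
  linear_combination h

end Paley

section QuadraticResidue

variable {F L : Type*} [Field F] [Fintype F] [DecidableEq F] [Field L]

variable (F L) in
/-- The quadratic character of the finite field `F` with values in the field `L`. -/
def quadChar : MulChar F L := (quadraticChar F).ringHomComp (Int.castRingHom L)

theorem quadChar_isQuadratic : (quadChar F L).IsQuadratic := (quadraticChar_isQuadratic F).comp _

theorem quadChar_of_isSquare {r : F} (hr : r ≠ 0) (hsq : IsSquare r) : quadChar F L r = 1 := by
  simp [quadChar, (quadraticChar_one_iff_isSquare hr).2 hsq]

theorem quadChar_of_not_isSquare {r : F} (hsq : ¬IsSquare r) : quadChar F L r = -1 := by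
  simp [quadChar, quadraticChar_neg_one_iff_not_isSquare.2 hsq]

theorem quadChar_neg_one_ne_zero : quadChar F L (-1) ≠ 0 :=
  (isUnit_one.neg.map (quadChar F L)).ne_zero

theorem quadChar_neg (r : F) : quadChar F L (-r) = quadChar F L (-1) * quadChar F L r := by
  rw [← map_mul, neg_one_mul]

theorem quadChar_ne_one (hF : ringChar F ≠ 2) (h2 : (2 : L) ≠ 0) : quadChar F L ≠ 1 := by
  obtain ⟨n, hn⟩ := FiniteField.exists_nonsquare hF
  have hn0 : n ≠ 0 := fun h => hn (h ▸ IsSquare.zero)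
  intro h
  have h1 : (-1 : L) = 1 := by
    rw [← quadChar_of_not_isSquare hn, h, MulChar.one_apply hn0.isUnit]
  exact h2 (by linear_combination -h1)

variable {ψ : AddChar F L} {f : F → L}

theorem paley_quadChar_of_fourier_eq_zero (hF : ringChar F ≠ 2) (hcard : (Fintype.card F : L) ≠ 0)
    (h2 : (2 : L) ≠ 0) (hψ : ψ.IsPrimitive) (hf : ∀ r, IsSquare r → fourier ψ f r = 0) :
    paley (quadChar F L) f = -(quadChar F L (-1) * gaussSum (quadChar F L) ψ) • f := by
  refine fourier_injective hψ hcard (funext fun r => ?_)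
  rw [fourier_paley (quadChar_ne_one hF h2), quadChar_isQuadratic.inv, map_smul, Pi.smul_apply,
    smul_eq_mul]
  by_cases hr : IsSquare r
  · rw [hf r hr, mul_zero, mul_zero]
  · rw [quadChar_neg, quadChar_of_not_isSquare hr]
    ring

end QuadraticResidue

section SquareRootBound

theorem hammingNorm_comp_bijective {ι κ M : Type*} [Fintype ι] [Fintype κ] [DecidableEq M] [Zero M]
    {e : ι → κ} (he : e.Bijective) (f : κ → M) :
    hammingNorm (fun i => f (e i)) = hammingNorm f :=
  card_equiv (Equiv.ofBijective e he) (by simp)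

variable {F L : Type*} [Field F] [Fintype F] [Field L] [DecidableEq L] {ψ : AddChar F L} {f : F → L}

theorem sqrt_card_add_one_le_hammingNorm_of_apply_zero_ne_zero (hF : ringChar F ≠ 2)
    (hcard : (Fintype.card F : L) ≠ 0) (h2 : (2 : L) ≠ 0) (hψ : ψ.IsPrimitive)
    (hf : ∀ r, IsSquare r → fourier ψ f r = 0) (hf0 : f 0 ≠ 0) :
    √(Fintype.card F) + 1 ≤ hammingNorm f := by
  classical
  set χ := quadChar F L
  have hχ1 : χ ≠ 1 := quadChar_ne_one hF h2
  have hG : χ (-1) * gaussSum χ ψ ≠ 0 := mul_ne_zero quadChar_neg_one_ne_zero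
    (gaussSum_ne_zero_of_nontrivial hcard hχ1 hψ)
  have hg (r : F) := fourier_gleasonPrange quadChar_isQuadratic hχ1 hψ
    (paley_quadChar_of_fourier_eq_zero hF hcard h2 hψ hf)
    (by rw [← fourier_apply_zero ψ, hf 0 IsSquare.zero]) r
  rw [← hammingNorm_gleasonPrange_add_one χ hf0, Nat.cast_add_one, add_le_add_iff_right]
  refine sqrt_card_le_hammingNorm_of_fourier_zero_ne_zero hF hψ (fun r hr hsq => ?_) fun h0 => ?_
  · have h := hg r
    rw [if_neg hr, quadChar_neg r, quadChar_of_isSquare hr hsq, mul_one] at h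
    refine (mul_eq_zero.1 h).resolve_left fun h' => mul_ne_zero h2 hG ?_
    linear_combination -h'
  · have h := hg 0
    rw [h0, mul_zero, if_pos rfl] at h
    exact mul_ne_zero hcard hf0 h.symm

theorem sqrt_card_add_one_le_hammingNorm (hF : ringChar F ≠ 2)
    (hcard : (Fintype.card F : L) ≠ 0) (h2 : (2 : L) ≠ 0) (hψ : ψ.IsPrimitive)
    (hf : ∀ r, IsSquare r → fourier ψ f r = 0) (hne : f ≠ 0) :
    √(Fintype.card F) + 1 ≤ hammingNorm f := by
  obtain ⟨t, ht⟩ := Function.ne_iff.1 hne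
  rw [← hammingNorm_comp_bijective (Equiv.addRight t).bijective f]
  refine sqrt_card_add_one_le_hammingNorm_of_apply_zero_ne_zero hF hcard h2 hψ
    (fun r hr => ?_) (by simpa using ht)
  exact (fourier_comp_add_right ψ f t r).trans (by rw [hf r hr, mul_zero])

theorem sqrt_card_le_hammingNorm (hF : ringChar F ≠ 2) (hcard : (Fintype.card F : L) ≠ 0)
    (h2 : (2 : L) ≠ 0) (hψ : ψ.IsPrimitive)
    (hf : ∀ r ≠ 0, IsSquare r → fourier ψ f r = 0) (hne : f ≠ 0) :
    √(Fintype.card F) ≤ hammingNorm f := by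
  by_cases hf0 : fourier ψ f 0 = 0
  · have hf' (r : F) (hr : IsSquare r) : fourier ψ f r = 0 := by
      rcases eq_or_ne r 0 with rfl | hr0
      exacts [hf0, hf r hr0 hr]
    linarith [sqrt_card_add_one_le_hammingNorm hF hcard h2 hψ hf' hne]
  · exact sqrt_card_le_hammingNorm_of_fourier_zero_ne_zero hF hψ hf hf0

end SquareRootBound

section FrobeniusOrbits

theorem ne_zero_and_isSquare_iff_exists_eq_pow {F : Type*} [Field F] [Fintype F]
    (hF : ringChar F ≠ 2) {q : F} (hq : orderOf q = Fintype.card F / 2) {r : F} :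
    r ≠ 0 ∧ IsSquare r ↔ ∃ j : ℕ, r = q ^ j := by
  have hcard : Fintype.card F / 2 ≠ 0 := (Nat.div_pos Fintype.one_lt_card two_pos).ne'
  have : NeZero (Fintype.card F / 2) := ⟨hcard⟩
  have hroot : IsPrimitiveRoot q (Fintype.card F / 2) := hq ▸ IsPrimitiveRoot.orderOf q
  constructor
  · rintro ⟨hr, hsq⟩
    obtain ⟨j, -, hj⟩ := hroot.eq_pow_of_pow_eq_one ((FiniteField.isSquare_iff hF hr).1 hsq)
    exact ⟨j, hj.symm⟩
  · rintro ⟨j, rfl⟩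
    have hj : q ^ j ≠ 0 := pow_ne_zero j (hroot.ne_zero hcard)
    refine ⟨hj, (FiniteField.isSquare_iff hF hj).2 ?_⟩
    rw [pow_right_comm, hroot.pow_eq_one, one_pow]

variable {R K L : Type*} [CommRing R] [Fintype R] [Field K] [Field L] [Algebra K L]
  {ψ : AddChar R L}

theorem fourier_algebraMap_card_mul [Finite K] (g : R → K) (r : R) :
    fourier ψ (fun x => algebraMap K L (g x)) (Nat.card K * r)
      = fourier ψ (fun x => algebraMap K L (g x)) r ^ Nat.card K := by
  cases nonempty_fintype K
  have hfrob (y : L) : y ^ Nat.card K = FiniteField.frobeniusAlgHom K L y := by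
    rw [FiniteField.coe_frobeniusAlgHom, Nat.card_eq_fintype_card]
  rw [fourier_apply, fourier_apply, hfrob, map_sum]
  refine sum_congr rfl fun x _ => ?_
  rw [map_mul (FiniteField.frobeniusAlgHom K L), AlgHom.commutes, ← hfrob,
    ← AddChar.map_nsmul_eq_pow, nsmul_eq_mul, mul_left_comm (x : R)]

theorem fourier_trace_eq_zero [Finite L] (hψ : ψ.IsPrimitive) (a : L) {r : R}
    (hr : ∀ j : ℕ, r ≠ -(Nat.card K : R) ^ j) :
    fourier ψ (fun x => algebraMap K L (Algebra.trace K L (a * ψ x))) r = 0 := by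
  classical
  simp only [fourier_apply, FiniteField.algebraMap_trace_eq_sum_pow, sum_mul]
  rw [sum_comm]
  refine sum_eq_zero fun j _ => ?_
  have hterm (x : R) : (a * ψ x) ^ Nat.card K ^ j * ψ (x * r)
      = a ^ Nat.card K ^ j * ψ (x * (Nat.card K ^ j + r)) := by
    rw [mul_pow, mul_assoc, ← AddChar.map_nsmul_eq_pow, ← AddChar.map_add_eq_mul, nsmul_eq_mul,
      Nat.cast_pow, mul_comm _ x, ← mul_add]
  have hne : (Nat.card K : R) ^ j + r ≠ 0 := fun h => hr j (eq_neg_of_add_eq_zero_right h)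
  simp only [hterm]
  rw [← mul_sum, AddChar.sum_mulShift _ hψ, if_neg hne, Nat.cast_zero, mul_zero]

end FrobeniusOrbits

section QuadraticResidueCodes

variable {F K L : Type*} [Field F] [Fintype F] [Field K] [Field L] [Algebra K L]
  {ψ : AddChar F L}

theorem algebraMap_comp_ne_zero {ι : Type*} {g : ι → K} (hg : g ≠ 0) :
    (fun i => algebraMap K L (g i)) ≠ 0 := by
  simpa [funext_iff] using hg

variable [DecidableEq K]

theorem hammingNorm_algebraMap_comp {ι : Type*} [Fintype ι] [DecidableEq L] (g : ι → K) :
    hammingNorm (fun i => algebraMap K L (g i)) = hammingNorm g :=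
  hammingNorm_comp (fun _ => algebraMap K L) (fun _ => (algebraMap K L).injective)
    fun _ => map_zero _

/-- Frobenius propagates the zero at the frequency `1` to all powers of `|K|`. -/
theorem sqrt_card_le_hammingNorm_of_fourier_one_eq_zero [Finite K] (hF : ringChar F ≠ 2)
    (hcard : (Fintype.card F : L) ≠ 0) (h2 : (2 : L) ≠ 0) (hψ : ψ.IsPrimitive)
    (hq : orderOf (Nat.card K : F) = Fintype.card F / 2) {g : F → K}
    (hg : fourier ψ (fun x => algebraMap K L (g x)) 1 = 0) (hne : g ≠ 0) :
    √(Fintype.card F) ≤ hammingNorm g := by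
  classical
  rw [← hammingNorm_algebraMap_comp (L := L)]
  refine sqrt_card_le_hammingNorm hF hcard h2 hψ (fun r hr hsq => ?_) (algebraMap_comp_ne_zero hne)
  obtain ⟨j, rfl⟩ := (ne_zero_and_isSquare_iff_exists_eq_pow hF hq).1 ⟨hr, hsq⟩
  clear hr hsq
  induction j with
  | zero => rw [pow_zero, hg]
  | succ j ih => rw [pow_succ', fourier_algebraMap_card_mul, ih, zero_pow Nat.card_pos.ne']

theorem sqrt_card_add_one_le_hammingNorm_trace [Finite L] (hF : ringChar F ≠ 2)
    (hcard : (Fintype.card F : L) ≠ 0) (h2 : (2 : L) ≠ 0) (hψ : ψ.IsPrimitive)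
    (hq : orderOf (Nat.card K : F) = Fintype.card F / 2) (a : L)
    (hne : (fun x => Algebra.trace K L (a * ψ x)) ≠ 0) :
    √(Fintype.card F) + 1 ≤ hammingNorm fun x => Algebra.trace K L (a * ψ x) := by
  classical
  -- For a nonsquare `n`, the transform of a trace word vanishes at `-(n * r)` for all squares `r`.
  obtain ⟨n, hn⟩ := FiniteField.exists_nonsquare hF
  have hn0 : n ≠ 0 := fun h => hn (h ▸ IsSquare.zero)
  have hψn : (ψ.mulShift (-n)).IsPrimitive := .of_ne_one (hψ (neg_ne_zero.2 hn0))
  rw [← hammingNorm_algebraMap_comp (L := L)]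
  refine sqrt_card_add_one_le_hammingNorm hF hcard h2 hψn (fun r hr => ?_)
    (algebraMap_comp_ne_zero hne)
  rw [fourier_mulShift]
  refine fourier_trace_eq_zero hψ a fun j hj => ?_
  rw [neg_mul, neg_inj] at hj
  obtain ⟨hnr0, hnr⟩ := (ne_zero_and_isSquare_iff_exists_eq_pow hF hq).2 ⟨j, hj⟩
  exact hn (by simpa [right_ne_zero_of_mul hnr0] using hnr.div hr)

end QuadraticResidueCodes

section Twist

variable {K L : Type*} [Field K] [Field L] [Algebra K L] {ρ : ℕ} [NeZero ρ]

/-- The word `c` with alternating signs, indexed by `ZMod ρ`; for odd `ρ` this turns negacyclic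
codes of length `ρ` into cyclic ones. -/
def twist (c : Fin ρ → K) (x : ZMod ρ) : K := (-1) ^ x.val * c ⟨x.val, x.val_lt⟩

theorem natCast_fin_bijective : Function.Bijective fun i : Fin ρ => ((i : ℕ) : ZMod ρ) :=
  Function.bijective_iff_has_inverse.2 ⟨fun x => ⟨x.val, x.val_lt⟩,
    fun i => Fin.ext (ZMod.val_natCast_of_lt i.isLt), ZMod.natCast_zmod_val⟩

theorem twist_natCast (c : Fin ρ → K) (i : Fin ρ) :
    twist c ((i : ℕ) : ZMod ρ) = (-1) ^ (i : ℕ) * c i := by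
  simp only [twist, ZMod.val_natCast_of_lt i.isLt]

theorem hammingNorm_twist [DecidableEq K] (c : Fin ρ → K) :
    hammingNorm (twist c) = hammingNorm c := by
  rw [← hammingNorm_comp_bijective natCast_fin_bijective]
  simp only [twist_natCast]
  exact hammingNorm_comp (fun (i : Fin ρ) => ((-1) ^ (i : ℕ) * ·))
    (fun _ => mul_right_injective₀ (by simp)) (by simp)

theorem twist_ne_zero {c : Fin ρ → K} (hc : c ≠ 0) : twist c ≠ 0 := by
  classical
  rwa [← hammingNorm_ne_zero_iff, hammingNorm_twist, hammingNorm_ne_zero_iff]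

theorem fourier_twist_one {γ : L} (hγ : (-γ) ^ ρ = 1) (c : Fin ρ → K) :
    fourier (AddChar.zmodChar ρ hγ) (fun x => algebraMap K L (twist c x)) 1
      = ∑ i : Fin ρ, c i • γ ^ (i : ℕ) := by
  rw [fourier_apply, ← natCast_fin_bijective.sum_comp]
  refine sum_congr rfl fun i _ => ?_
  rw [mul_one, twist_natCast, AddChar.zmodChar_apply', Algebra.smul_def, map_mul, map_pow,
    map_neg, map_one, mul_right_comm, ← mul_pow, neg_one_mul, neg_neg, mul_comm]

theorem twist_trace {γ : L} (hγ : (-γ) ^ ρ = 1) (a : L) :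
    twist (fun i : Fin ρ => Algebra.trace K L (a * γ ^ (i : ℕ)))
      = fun x => Algebra.trace K L (a * AddChar.zmodChar ρ hγ x) := by
  funext x
  rw [twist, ← smul_eq_mul, ← map_smul, Algebra.smul_def, map_pow, map_neg, map_one,
    AddChar.zmodChar_apply, neg_pow γ, mul_left_comm]

end Twist

section LinearCodes

variable {K : Type*} [Field K] {n : ℕ} {C : Submodule K (Fin n → K)}

open Classical in
theorem le_minDist (hC : C ≠ ⊥) {b : ℝ} (hb : ∀ c ∈ C, c ≠ 0 → b ≤ hammingNorm c) :
    b ≤ minDist C := by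
  obtain ⟨c, hc, hc0⟩ := Submodule.exists_mem_ne_zero_of_ne_bot hC
  obtain ⟨x, hx, y, hy, hxy, hd⟩ :=
    Nat.sInf_mem (s := {d | ∃ x ∈ C, ∃ y ∈ C, x ≠ y ∧ hammingDist x y = d})
      ⟨_, c, hc, 0, C.zero_mem, hc0, rfl⟩
  rw [minDist, ← hd, hammingDist_eq_hammingNorm]
  exact hb _ (C.add_mem (C.neg_mem hx) hy) fun h => hxy (neg_add_eq_zero.1 h)

theorem finrank_add_finrank_dualCode (C : Submodule K (Fin n → K)) :
    Module.finrank K C + Module.finrank K (dualCode C) = n := by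
  have hdual : dualCode C = C.dualAnnihilator.comap (dotProductEquiv K (Fin n)).toLinearMap := by
    ext c
    simp [Submodule.mem_dualAnnihilator, dualCode, dotProduct]
  rw [hdual, LinearEquiv.finrank_eq ((dotProductEquiv K (Fin n)).ofSubmodule' _),
    Subspace.finrank_add_finrank_dualAnnihilator_eq, Module.finrank_fin_fun]

end LinearCodes

section SimpleExtensions

variable {K L : Type*} [Field K] [Field L] [Algebra K L] {n : ℕ} [NeZero n]

theorem span_range_pow_eq_adjoin {γ : L} {u : K} (h : γ ^ n = algebraMap K L u) :
    Submodule.span K (Set.range fun i : Fin n => γ ^ (i : ℕ))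
      = Subalgebra.toSubmodule (Algebra.adjoin K {γ}) := by
  have hroot : Polynomial.aeval γ (.X ^ n - .C u : Polynomial K) = 0 := by simp [h]
  rw [← Submodule.span_range_natDegree_eq_adjoin (Polynomial.monic_X_pow_sub_C u (NeZero.ne n))
    hroot, Polynomial.natDegree_X_pow_sub_C]
  congr 1
  ext x
  simp [Fin.exists_iff]

theorem adjoin_singleton_neg (γ : L) : Algebra.adjoin K {-γ} = Algebra.adjoin K {γ} := by
  refine le_antisymm (Algebra.adjoin_singleton_le (neg_mem ?_)) (Algebra.adjoin_singleton_le ?_)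
  · exact Algebra.self_mem_adjoin_singleton K γ
  · exact neg_mem_iff.1 (Algebra.self_mem_adjoin_singleton K (-γ))

theorem finrank_adjoin_eq_orderOf [Finite L] {ζ : L} (hζ : IsPrimitiveRoot ζ n) :
    Module.finrank K (Algebra.adjoin K {ζ}) = orderOf (Nat.card K : ZMod n) := by
  have : Finite K := Finite.of_injective _ (algebraMap K L).injective
  cases nonempty_fintype K
  obtain ⟨p, hchar, f, hp, hcard⟩ := FiniteField.card' K
  have : Fact p.Prime := ⟨hp⟩
  have : CharP L p := charP_of_injective_algebraMap' K p
  have : NeZero (n : L) := hζ.neZero'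
  have hcop : p.Coprime n := hp.coprime_iff_not_dvd.2 fun hdvd =>
    NeZero.ne (n : L) ((CharP.cast_eq_zero_iff L p n).2 hdvd)
  have hint : IsIntegral K ζ := .of_finite K ζ
  have hdvd : minpoly K ζ ∣ Polynomial.cyclotomic n K := minpoly.dvd K ζ <| by
    rw [Polynomial.aeval_def, ← Polynomial.eval_map, Polynomial.map_cyclotomic]
    exact hζ.isRoot_cyclotomic (NeZero.pos n)
  rw [(Algebra.adjoin.powerBasis hint).finrank, Algebra.adjoin.powerBasis_dim,
    Polynomial.natDegree_of_dvd_cyclotomic_of_irreducible hcard hcop hdvd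
      (minpoly.irreducible hint), ← orderOf_units, ZMod.coe_unitOfCoprime,
    Nat.card_eq_fintype_card, hcard]

end SimpleExtensions

section TraceCode

variable {K L : Type*} [Field K] [Field L] [Algebra K L] {n : ℕ} {β : L}

theorem isConstacyclic_barCode {u : K} (hβ : β ≠ 0) (h : β ^ (2 * n) = algebraMap K L u) :
    IsConstacyclic u (barCode K n β) := by
  intro c hc
  obtain ⟨a, rfl⟩ := (mem_barCode n β c).1 hc
  refine (mem_barCode n β _).2 ⟨a * β ^ 2, ?_⟩
  funext i
  have hshift (k : ℕ) : a * β ^ 2 * β⁻¹ ^ (2 * (k + 1)) = a * β⁻¹ ^ (2 * k) := by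
    rw [mul_add, pow_add, mul_one]
    field_simp
  dsimp only
  split_ifs with hi
  · rw [hi, mul_zero, pow_zero, mul_one, ← hshift (n - 1), Nat.sub_add_cancel i.pos,
      ← smul_eq_mul, ← map_smul, Algebra.smul_def, ← h, inv_pow]
    field_simp
  · rw [← hshift, Nat.sub_add_cancel (Nat.pos_of_ne_zero hi)]

theorem mem_dualCode_barCode [FiniteDimensional K L] [Algebra.IsSeparable K L] (c : Fin n → K) :
    c ∈ dualCode (barCode K n β) ↔ ∑ i : Fin n, c i • (β⁻¹ ^ 2) ^ (i : ℕ) = 0 := by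
  have hpairing (a : L) : ∑ i, c i * Algebra.trace K L (a * β⁻¹ ^ (2 * (i : ℕ)))
      = Algebra.traceForm K L (∑ i : Fin n, c i • (β⁻¹ ^ 2) ^ (i : ℕ)) a := by
    rw [Algebra.traceForm_apply, sum_mul, map_sum]
    refine sum_congr rfl fun i _ => ?_
    rw [smul_mul_assoc, map_smul, smul_eq_mul, pow_mul, mul_comm a]
  have hmem : c ∈ dualCode (barCode K n β) ↔
      ∀ a : L, Algebra.traceForm K L (∑ i : Fin n, c i • (β⁻¹ ^ 2) ^ (i : ℕ)) a = 0 := by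
    simp only [← hpairing]
    constructor
    · exact fun hc a => hc _ ((mem_barCode n β _).2 ⟨a, rfl⟩)
    · intro hc b hb
      obtain ⟨a, rfl⟩ := (mem_barCode n β b).1 hb
      exact hc a
  rw [hmem]
  refine ⟨(traceForm_nondegenerate K L).1 _, fun h a => by rw [h, map_zero, LinearMap.zero_apply]⟩

theorem finrank_barCode [FiniteDimensional K L] [Algebra.IsSeparable K L] :
    Module.finrank K (barCode K n β)
      = Module.finrank K (Submodule.span K (Set.range fun i : Fin n => (β⁻¹ ^ 2) ^ (i : ℕ))) := by
  have hker : dualCode (barCode K n β)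
      = LinearMap.ker (Fintype.linearCombination K fun i : Fin n => (β⁻¹ ^ 2) ^ (i : ℕ)) := by
    ext c
    rw [mem_dualCode_barCode, LinearMap.mem_ker, Fintype.linearCombination_apply]
  have hdual := finrank_add_finrank_dualCode (barCode K n β)
  have hrank := LinearMap.finrank_range_add_finrank_ker
    (Fintype.linearCombination K fun i : Fin n => (β⁻¹ ^ 2) ^ (i : ℕ))
  rw [Fintype.range_linearCombination, Module.finrank_fin_fun, ← hker] at hrank
  omega

end TraceCode

section RootsOfUnity

theorem four_mul_dvd_pow_sub_one {n q : ℕ} (hn : Odd n) (hq : Odd q)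
    (hord : (q : ZMod n) ^ (n - 1) = 1) : 4 * n ∣ q ^ (n - 1) - 1 := by
  have hcop : Nat.Coprime 4 n := hn.coprime_two_left.pow_left 2
  have hcast : ((1 : ℕ) : ZMod n) = (q ^ (n - 1) : ℕ) := by rw [Nat.cast_pow, hord, Nat.cast_one]
  refine hcop.mul_dvd_of_dvd_of_dvd ?_
    ((Nat.modEq_iff_dvd' (pow_pos hq.pos _)).1 ((ZMod.natCast_eq_natCast_iff _ _ _).1 hcast))
  obtain ⟨k, rfl⟩ := hn
  have hsq : 4 ∣ q ^ 2 - 1 := dvd_trans (by norm_num) (Nat.eight_dvd_sq_sub_one_of_odd hq)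
  rw [Nat.add_sub_cancel, pow_mul]
  simpa using hsq.trans (Nat.sub_dvd_pow_sub_pow (q ^ 2) 1 k)

variable {R : Type*} [CommRing R] [IsDomain R] {n : ℕ} {γ : R}

theorem pow_eq_neg_one_of_isPrimitiveRoot_two_mul (hn : 0 < n)
    (hγ : IsPrimitiveRoot γ (2 * n)) : γ ^ n = -1 :=
  (hγ.pow (Nat.mul_pos two_pos hn) (mul_comm 2 n)).eq_neg_one_of_two_right

theorem isPrimitiveRoot_neg_of_two_mul (hn : Odd n) (hγ : IsPrimitiveRoot γ (2 * n)) :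
    IsPrimitiveRoot (-γ) n := by
  have hpow := pow_eq_neg_one_of_isPrimitiveRoot_two_mul hn.pos hγ
  have hsq : IsPrimitiveRoot (γ ^ 2) n := hγ.pow (Nat.mul_pos two_pos hn.pos) rfl
  obtain ⟨k, rfl⟩ := hn
  have hneg : -γ = (γ ^ 2) ^ (k + 1) := by linear_combination -γ * hpow
  rw [hneg]
  exact hsq.pow_of_coprime _ (Nat.isCoprime_iff_coprime.1 ⟨2, -1, by push_cast; ring⟩)

end RootsOfUnity

section SquareRootBounds

variable {ρ : ℕ} {K L : Type*} [Field K] [Field L] [Algebra K L] [Finite L] {β : L}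

theorem finrank_barCode_eq_orderOf [NeZero ρ] (hβ : (β⁻¹ ^ 2) ^ ρ = -1)
    (hζ : IsPrimitiveRoot (-β⁻¹ ^ 2) ρ) :
    Module.finrank K (barCode K ρ β) = orderOf (Nat.card K : ZMod ρ) := by
  have : Finite K := Finite.of_injective _ (algebraMap K L).injective
  rw [finrank_barCode, span_range_pow_eq_adjoin (u := -1) (by rw [hβ, map_neg, map_one]),
    Subalgebra.finrank_toSubmodule, ← adjoin_singleton_neg, finrank_adjoin_eq_orderOf hζ]

variable [Fact ρ.Prime] [DecidableEq K]

theorem sqrt_add_one_le_hammingNorm_of_mem_barCode (hρ2 : ρ ≠ 2) (hρ : (ρ : L) ≠ 0)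
    (h2 : (2 : L) ≠ 0) (hq : orderOf (Nat.card K : ZMod ρ) = ρ / 2)
    (hζ : IsPrimitiveRoot (-β⁻¹ ^ 2) ρ) {c : Fin ρ → K} (hc : c ∈ barCode K ρ β) (hc0 : c ≠ 0) :
    √ρ + 1 ≤ hammingNorm c := by
  obtain ⟨a, rfl⟩ := (mem_barCode ρ β c).1 hc
  have hne := twist_ne_zero hc0
  rw [← hammingNorm_twist]
  simp only [pow_mul, twist_trace hζ.pow_eq_one] at hne ⊢
  have hbound := sqrt_card_add_one_le_hammingNorm_trace (by rwa [ZMod.ringChar_zmod_n])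
    (by rwa [ZMod.card]) h2 (AddChar.zmodChar_primitive_of_primitive_root ρ hζ)
    (by rwa [ZMod.card]) a hne
  rwa [ZMod.card] at hbound

theorem sqrt_le_hammingNorm_of_mem_dualCode_barCode (hρ2 : ρ ≠ 2) (hρ : (ρ : L) ≠ 0)
    (h2 : (2 : L) ≠ 0) (hq : orderOf (Nat.card K : ZMod ρ) = ρ / 2)
    (hζ : IsPrimitiveRoot (-β⁻¹ ^ 2) ρ) {c : Fin ρ → K} (hc : c ∈ dualCode (barCode K ρ β))
    (hc0 : c ≠ 0) : √ρ ≤ hammingNorm c := by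
  have : Finite K := Finite.of_injective _ (algebraMap K L).injective
  rw [mem_dualCode_barCode, ← fourier_twist_one hζ.pow_eq_one] at hc
  have hbound := sqrt_card_le_hammingNorm_of_fourier_one_eq_zero
    (by rwa [ZMod.ringChar_zmod_n]) (by rwa [ZMod.card]) h2
    (AddChar.zmodChar_primitive_of_primitive_root ρ hζ) (by rwa [ZMod.card]) hc (twist_ne_zero hc0)
  rwa [hammingNorm_twist, ZMod.card] at hbound

end SquareRootBounds

end Negacyclic

open Negacyclic in
theorem mainTheorem10_general {ρ : ℕ} (hprime : ρ.Prime) (hρ2 : ρ ≠ 2)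
    {K L : Type*} [Field K] [Field L] [Algebra K L] [Finite L]
    (hq : orderOf (Nat.card K : ZMod ρ) = (ρ - 1) / 2)
    {β : L} (hβ : IsPrimitiveRoot β (4 * ρ)) :
    IsNegacyclic (barCode K ρ β) ∧
    (∃ d : ℕ, HasParameters (barCode K ρ β) ((ρ - 1) / 2) d ∧ √(ρ : ℝ) + 1 ≤ d) ∧
    (∃ d : ℕ, HasParameters (dualCode (barCode K ρ β)) ((ρ + 1) / 2) d ∧ √(ρ : ℝ) ≤ d) := by
  classical
  have : Fact ρ.Prime := ⟨hprime⟩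
  have hodd : Odd ρ := hprime.odd_of_ne_two hρ2
  have ⟨k, hk⟩ := hodd
  have hk0 : 0 < k := by have := hprime.two_le; omega
  have h4ρ : (4 * ρ : L) ≠ 0 := by simpa using hβ.neZero'.out
  have hρ : (ρ : L) ≠ 0 := right_ne_zero_of_mul h4ρ
  have h2 : (2 : L) ≠ 0 := fun h => h4ρ (by linear_combination 2 * (ρ : L) * h)
  have hβρ : β ^ (2 * ρ) = -1 :=
    pow_eq_neg_one_of_isPrimitiveRoot_two_mul (by omega) (by rwa [← mul_assoc])
  have hζ : IsPrimitiveRoot (-β⁻¹ ^ 2) ρ :=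
    isPrimitiveRoot_neg_of_two_mul hodd (hβ.inv.pow (by omega) (by ring))
  have hC := finrank_barCode_eq_orderOf (K := K) (by rw [← pow_mul, inv_pow, hβρ, inv_neg_one]) hζ
  have hD := finrank_add_finrank_dualCode (barCode K ρ β)
  have hq' : orderOf (Nat.card K : ZMod ρ) = ρ / 2 := by omega
  refine ⟨isConstacyclic_barCode (hβ.ne_zero (by omega)) (by rw [hβρ, map_neg, map_one]),
    ⟨_, ⟨hC.trans hq, rfl⟩, le_minDist (Submodule.one_le_finrank_iff.1 (by omega)) fun c => ?_⟩,
    ⟨_, ⟨by omega, rfl⟩, le_minDist (Submodule.one_le_finrank_iff.1 (by omega)) fun c => ?_⟩⟩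
  · exact sqrt_add_one_le_hammingNorm_of_mem_barCode hρ2 hρ h2 hq' hζ
  · exact sqrt_le_hammingNorm_of_mem_dualCode_barCode hρ2 hρ h2 hq' hζ

theorem mainTheorem10 (ρ : ℕ) (hprime : ρ.Prime)
    (hmod : ρ ≡ 5 [MOD 12] ∨ ρ ≡ 7 [MOD 12])
    (hord : orderOf (3 : ZMod ρ) = ρ - 1)
    {K L : Type*} [Field K] [Field L] [Algebra K L]
    (hK : Nat.card K = 3 ^ 2) (hL : Nat.card L = 3 ^ (ρ - 1))
    (α : L) (hα : IsPrimitiveRoot α (3 ^ (ρ - 1) - 1))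
    (β : L) (hβ : β = α ^ ((3 ^ (ρ - 1) - 1) / (4 * ρ))) :
    Negacyclic.IsNegacyclic (Negacyclic.barCode K ρ β) ∧
    (∃ d : ℕ, Negacyclic.HasParameters (Negacyclic.barCode K ρ β) ((ρ - 1) / 2) d ∧
      Real.sqrt (ρ : ℝ) + 1 ≤ (d : ℝ)) ∧
    (∃ d : ℕ, Negacyclic.HasParameters (Negacyclic.dualCode (Negacyclic.barCode K ρ β))
        ((ρ + 1) / 2) d ∧
      Real.sqrt (ρ : ℝ) ≤ (d : ℝ)) := by
  have hρ2 : ρ ≠ 2 := by rintro rfl; revert hmod; decide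
  have heven : 2 ∣ ρ - 1 := (hprime.even_sub_one hρ2).two_dvd
  have hpos : 0 < ρ - 1 := Nat.sub_pos_of_lt hprime.one_lt
  have : Finite L := Nat.finite_of_card_ne_zero (by rw [hL]; positivity)
  have hdvd : 4 * ρ ∣ 3 ^ (ρ - 1) - 1 := Negacyclic.four_mul_dvd_pow_sub_one
    (hprime.odd_of_ne_two hρ2) (by decide) (by rw [Nat.cast_ofNat, ← hord, pow_orderOf_eq_one])
  refine mainTheorem10_general hprime hρ2 ?_ (hβ ▸ hα.pow ?_ (Nat.div_mul_cancel hdvd).symm)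
  · rw [hK, Nat.cast_pow, Nat.cast_ofNat, orderOf_pow' _ two_ne_zero, hord,
      Nat.gcd_eq_right heven]
  · exact Nat.sub_pos_of_lt (Nat.one_lt_pow hpos.ne' (by norm_num))
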